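/- Let $T$ be a finite tree and let $e$ be an edge of $T$. Let $T^{*}$ be the tree obtained from $T$ by contracting $e$. For a finite tree $S$, let $\mu_S$ denote its mean subtree order, that is, the average number of vertices of the (nonempty) subtrees of $S$. Then \[ \mu_T-\mu_{T^{*}}\ge\frac13, \] with equality if and only if $T$ is a path. -/

import Mathlib

namespace SimpleGraph

/-- The subtrees of a graph: its subgraphs that are trees. A tree is connected, hence nonempty,
so the empty subgraph is not a subtree. -/
def subtrees {V : Type*} (G : SimpleGraph V) : Set G.Subgraph :=
  {H | H.coe.IsTree}

/-- The mean subtree order (global mean) of a graph on finitely many vertices: the average number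
of vertices of its subtrees. -/
noncomputable def meanSubtreeOrder {V : Type*} (G : SimpleGraph V) : ℝ :=
  (∑ᶠ H ∈ G.subtrees, (H.verts.ncard : ℝ)) / (G.subtrees.ncard : ℝ)

/-- The equivalence relation on the vertices that identifies the two ends of `e` and nothing
else. -/
def contractSetoid {V : Type*} (e : Sym2 V) : Setoid V where
  r x y := x = y ∨ (x ∈ e ∧ y ∈ e)
  iseqv :=
    { refl := fun _ => Or.inl rfl
      symm := by
        rintro x y (h | ⟨h₁, h₂⟩)
        · exact Or.inl h.symm
        · exact Or.inr ⟨h₂, h₁⟩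
      trans := by
        rintro x y z (rfl | ⟨h₁, h₂⟩) (rfl | ⟨h₃, h₄⟩)
        · exact Or.inl rfl
        · exact Or.inr ⟨h₃, h₄⟩
        · exact Or.inr ⟨h₁, h₂⟩
        · exact Or.inr ⟨h₁, h₄⟩ }

/-- Contraction of the edge `e`: the two ends of `e` become one vertex, and two distinct vertices
of the new graph are adjacent when some of their representatives are adjacent in `G`
(`SimpleGraph.map` discards the loop). -/
def contractEdge {V : Type*} (G : SimpleGraph V) (e : Sym2 V) :
    SimpleGraph (Quotient (contractSetoid e)) :=
  G.map (Quotient.mk (contractSetoid e))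

/-- A graph is a path if it is isomorphic to the path graph on some number of vertices. -/
def IsPathGraph {V : Type*} (G : SimpleGraph V) : Prop :=
  ∃ n : ℕ, Nonempty (G ≃g pathGraph n)

end SimpleGraph

/-! Delete `e = uw` and root the two components `A`, `B` at `u` and `w`. Let `a`, `t` be the number
and total order of the subtrees of `A` through `u`, and `α`, `s` those of the subtrees avoiding `u`;
let `b`, `r`, `β`, `q` play these roles for `B`. Subtrees of `T` containing both ends of `e` or
neither correspond to the subtrees of the contraction, the former losing one vertex; those
containing exactly one end are extra. So the contraction has `α + β + ab` subtrees, `T` has `a + b`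
more, and the total order grows by `ab + t + r`. Clearing denominators turns the claim into a
polynomial inequality in these eight numbers.

It follows from three bounds on each side: `2α ≤ a(a - 1)`, `3t ≤ a² + 2a + α` and `3sa ≤ α(3t - α -
a)`, all attained by a path rooted at an end. A rooted tree is built from single vertices by making
one root a new child of another, that is, by `RootedBounds.succ` followed by `RootedBounds.merge`,
and both operations preserve the bounds. `joined_identity` expresses the target through the slacks
of the bounds, and `weighted_diff_le` controls the only term of variable sign.

Equality forces `3t = a² + 2a + α` on both sides. Merging two nontrivial rooted trees makes this
bound strict, so each side is a path ending at its root and `T` is a path. Conversely, in a path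
both sides attain all the bounds. -/

namespace SimpleGraph

/-! ### Real inequalities for rooted trees -/

/-- Invariants of a rooted tree: `a` and `t` are the number and the total order of the subtrees
containing the root, `α` and `s` those of the subtrees avoiding it. -/
structure RootedBounds (a t α s : ℝ) : Prop where
  count : a = 1 ∨ 2 ≤ a
  count_le_total : a ≤ t
  avoid_nonneg : 0 ≤ α
  avoid_le : 2 * α ≤ a * (a - 1)
  total_le : 0 ≤ a ^ 2 + 2 * a - 3 * t + α
  avoid_total_le : 0 ≤ 3 * α * t - 3 * s * a - α ^ 2 - α * a

theorem RootedBounds.one_le {a t α s : ℝ} (h : RootedBounds a t α s) : 1 ≤ a := by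
  rcases h.count with h | h <;> linarith

theorem RootedBounds.single : RootedBounds 1 1 0 0 := by
  constructor <;> norm_num

/-- Hanging a rooted tree below a new root. -/
theorem RootedBounds.succ {c t γ s : ℝ} (h : RootedBounds c t γ s) :
    RootedBounds (1 + c) (1 + c + t) (c + γ) (t + s) := by
  have h1 := h.one_le
  have h2 := h.count_le_total
  have h3 := h.avoid_nonneg
  have h4 := h.avoid_le
  have h5 := h.total_le
  have h6 := h.avoid_total_le
  refine ⟨Or.inr (by linarith), by linarith, by linarith, by nlinarith, by nlinarith, ?_⟩
  -- Adding `γ * c` times `h5` to `c` times `h6` eliminates `t` and leaves `c ^ 2` times this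
  -- quantity. The remaining goal is then exactly the sum of `h5`, `h6` and `h7`.
  have h7 : 0 ≤ γ * c + γ - 3 * s := by
    have h8 : 0 ≤ c * (γ * c + γ - 3 * s) := by
      have : 0 ≤ c * (γ * c + γ - 3 * s) * c := by
        have h9 := mul_nonneg h3 h5
        have h10 := mul_nonneg (by linarith : 0 ≤ c) h9
        have h11 := mul_nonneg (by linarith : 0 ≤ c) h6
        nlinarith
      exact nonneg_of_mul_nonneg_left this (by linarith)
    exact nonneg_of_mul_nonneg_right h8 (by linarith)
  nlinarith

/-- The left side is kept, rather than `0`, because it is positive as soon as both `a₁` and `a₂`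
exceed `1`; this drives the equality case. It is what remains of `a₁ * a₂ * (a₁ - 1) * (a₂ - 1)`
after bounding `α₁` and `α₂` by `avoid_le`. -/
theorem merge_total_bound {a₁ t₁ α₁ s₁ a₂ t₂ α₂ s₂ : ℝ} (h₁ : RootedBounds a₁ t₁ α₁ s₁)
    (h₂ : RootedBounds a₂ t₂ α₂ s₂) :
    (a₁ - 1) * (a₂ - 1) * (a₁ * a₂ - (a₁ + a₂) / 2) ≤
      (a₁ * a₂) ^ 2 + 2 * (a₁ * a₂) - 3 * (t₁ * a₂ + a₁ * t₂ - a₁ * a₂) + (α₁ + α₂) := by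
  have h1 := h₁.one_le
  have h2 := h₂.one_le
  have h3 := mul_nonneg (by linarith : 0 ≤ a₂) h₁.total_le
  have h4 := mul_nonneg (by linarith : 0 ≤ a₁) h₂.total_le
  have h5 := mul_le_mul_of_nonneg_right h₁.avoid_le (sub_nonneg.2 h2)
  have h6 := mul_le_mul_of_nonneg_right h₂.avoid_le (sub_nonneg.2 h1)
  nlinarith

/-- Identifying the roots of two rooted trees. -/
theorem RootedBounds.merge {a₁ t₁ α₁ s₁ a₂ t₂ α₂ s₂ : ℝ} (h₁ : RootedBounds a₁ t₁ α₁ s₁)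
    (h₂ : RootedBounds a₂ t₂ α₂ s₂) :
    RootedBounds (a₁ * a₂) (t₁ * a₂ + a₁ * t₂ - a₁ * a₂) (α₁ + α₂) (s₁ + s₂) := by
  have h1 := h₁.one_le
  have h2 := h₂.one_le
  have h3 := h₁.count_le_total
  have h4 := h₂.count_le_total
  have h5 := h₁.avoid_nonneg
  have h6 := h₂.avoid_nonneg
  refine ⟨?_, by nlinarith, by linarith, ?_, ?_, ?_⟩
  · rcases h₁.count with h | h <;> rcases h₂.count with h' | h'
    · left; rw [h, h', one_mul]
    all_goals right; nlinarith
  · have := h₁.avoid_le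
    have := h₂.avoid_le
    have : 0 ≤ (a₁ - 1) * (a₂ - 1) := mul_nonneg (by linarith) (by linarith)
    have : 0 ≤ (a₁ - 1) * (a₂ - 1) * (a₁ * a₂ + a₁ + a₂) := mul_nonneg this (by nlinarith)
    nlinarith [mul_nonneg (sub_nonneg.2 h1) (sub_nonneg.2 h2)]
  · refine le_trans ?_ (merge_total_bound h₁ h₂)
    have : 0 ≤ (a₁ - 1) * (a₂ - 1) := mul_nonneg (by linarith) (by linarith)
    exact mul_nonneg this (by nlinarith)
  · have e1 := mul_nonneg (by linarith : 0 ≤ a₂) h₁.avoid_total_le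
    have e2 := mul_nonneg (by linarith : 0 ≤ a₁) h₂.avoid_total_le
    have e3 : 0 ≤ α₁ * a₁ * (t₂ - a₂) :=
      mul_nonneg (mul_nonneg h5 (by linarith)) (by linarith)
    have e4 : 0 ≤ α₂ * a₂ * (t₁ - a₁) :=
      mul_nonneg (mul_nonneg h6 (by linarith)) (by linarith)
    -- The cross term of `(α₁ + α₂) ^ 2` is where integrality enters: if `a₁, a₂ ≥ 2` this is AM-GM,
    -- and if some count is `1`, then `avoid_le` makes its `α` vanish.
    have key : 2 * (α₁ * α₂) ≤ α₁ ^ 2 * (a₂ - 1) + α₂ ^ 2 * (a₁ - 1) := by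
      rcases h₁.count with h | h
      · have : α₁ = 0 := by have := h₁.avoid_le; rw [h] at this; linarith
        rw [this, h]; simp
      rcases h₂.count with h' | h'
      · have : α₂ = 0 := by have := h₂.avoid_le; rw [h'] at this; linarith
        rw [this, h']; simp
      · nlinarith [sq_nonneg (α₁ - α₂), mul_nonneg (sq_nonneg α₁) (sub_nonneg.2 h'),
          mul_nonneg (sq_nonneg α₂) (sub_nonneg.2 h)]
    nlinarith

/-- Joining the root of the second tree, as a new child, to the root of the first. -/
theorem RootedBounds.join {a t α s c t' γ s' : ℝ} (h₁ : RootedBounds a t α s)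
    (h₂ : RootedBounds c t' γ s') :
    RootedBounds (a + a * c) (t + (t * c + a * t')) (α + (c + γ)) (s + (t' + s')) := by
  convert h₁.merge h₂.succ using 1 <;> ring

/-- The second factor of the merge, a tree hung below a new root, has count `1 + c > 1`, so the
slack in `merge_total_bound` is positive unless `a = 1`. -/
theorem RootedBounds.eq_zero_of_join {a t α s c t' γ s' : ℝ} (h₁ : RootedBounds a t α s)
    (h₂ : RootedBounds c t' γ s')
    (h : (a + a * c) ^ 2 + 2 * (a + a * c) - 3 * (t + (t * c + a * t')) + (α + (c + γ)) = 0) :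
    a = 1 := by
  have h1 := h₁.one_le
  have h2 := h₂.one_le
  by_contra hne
  have h3 : 1 < a := lt_of_le_of_ne h1 (Ne.symm hne)
  have h4 := merge_total_bound h₁ h₂.succ
  have h5 : 0 < (a - 1) * (1 + c - 1) := mul_pos (by linarith) (by linarith)
  have h6 : 0 < (a - 1) * (1 + c - 1) * (a * (1 + c) - (a + (1 + c)) / 2) :=
    mul_pos h5 (by nlinarith)
  nlinarith

/-- The difference of the two means minus `1 / 3`, up to a positive factor. -/
theorem joined_identity {a t α s b r β q : ℝ} (ha : a ≠ 0) (hb : b ≠ 0) :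
    a * b * (3 * (α + β + a * b) * (a * b + t + r)
      - 3 * (s + q + (t * b + a * r - a * b)) * (a + b)
      - (α + β + a * b) * (α + β + a * b + a + b)) =
    (a + b) * (b * (3 * α * t - 3 * s * a - α ^ 2 - α * a)
      + a * (3 * β * r - 3 * q * b - β ^ 2 - β * b)) +
    a ^ 2 * b ^ 2 * (1 / 2 * (a + b) *
        ((a ^ 2 + 2 * a - 3 * t + α) / a + (b ^ 2 + 2 * b - 3 * r + β) / b)
      - (((a - 1) / 2 - α / a) - ((b - 1) / 2 - β / b)) *
        ((a ^ 2 + 2 * a - 3 * t + α) / a - (b ^ 2 + 2 * b - 3 * r + β) / b)) := by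
  field_simp
  ring

/-- Here `ε`, `δ` stand for the normalised slacks of `avoid_le` and `z`, `w` for those of
`total_le`. Since `|z - w| ≤ z + w` and `|ε - δ|` stays below `(a + b) / 2`, the signed product
cannot cancel the main term; a positive multiple of `z + w` survives, which the equality case needs.
-/
theorem weighted_diff_le {a b ε δ z w : ℝ} (hε : 0 ≤ ε) (hδ : 0 ≤ δ)
    (hεa : ε ≤ (a - 1) / 2) (hδb : δ ≤ (b - 1) / 2) (hz : 0 ≤ z) (hw : 0 ≤ w) :
    1 / 2 * (z + w) ≤ 1 / 2 * (a + b) * (z + w) - (ε - δ) * (z - w) := by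
  have hεa' : 2 * ε ≤ a - 1 := by linarith
  have hδb' : 2 * δ ≤ b - 1 := by linarith
  nlinarith [mul_nonneg hz hε, mul_nonneg hz hδ, mul_nonneg hw hε, mul_nonneg hw hδ,
    mul_nonneg hz (sub_nonneg.2 hεa'), mul_nonneg hz (sub_nonneg.2 hδb'),
    mul_nonneg hw (sub_nonneg.2 hεa'), mul_nonneg hw (sub_nonneg.2 hδb')]

theorem joined_lower_bound {a t α s b r β q : ℝ} (h₁ : RootedBounds a t α s)
    (h₂ : RootedBounds b r β q) :
    a * b * (1 / 2 * ((a ^ 2 + 2 * a - 3 * t + α) / a + (b ^ 2 + 2 * b - 3 * r + β) / b)) ≤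
      3 * (α + β + a * b) * (a * b + t + r)
      - 3 * (s + q + (t * b + a * r - a * b)) * (a + b)
      - (α + β + a * b) * (α + β + a * b + a + b) := by
  have ha := h₁.one_le
  have hb := h₂.one_le
  have ha0 : 0 < a := by linarith
  have hb0 : 0 < b := by linarith
  have hab := mul_pos ha0 hb0
  refine le_of_mul_le_mul_left ?_ hab
  rw [joined_identity ha0.ne' hb0.ne']
  have hA : α / a ≤ (a - 1) / 2 := by
    rw [div_le_iff₀ ha0]; linarith [h₁.avoid_le]
  have hB : β / b ≤ (b - 1) / 2 := by
    rw [div_le_iff₀ hb0]; linarith [h₂.avoid_le]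
  have h := weighted_diff_le (sub_nonneg.2 hA) (sub_nonneg.2 hB)
    (by linarith [div_nonneg h₁.avoid_nonneg ha0.le])
    (by linarith [div_nonneg h₂.avoid_nonneg hb0.le])
    (div_nonneg h₁.total_le ha0.le) (div_nonneg h₂.total_le hb0.le)
  have h' := mul_le_mul_of_nonneg_left h (mul_pos hab hab).le
  have h3 := mul_nonneg hb0.le h₁.avoid_total_le
  have h4 := mul_nonneg ha0.le h₂.avoid_total_le
  have h5 := mul_nonneg (add_pos ha0 hb0).le (add_nonneg h3 h4)
  linarith

theorem mean_diff_eq {n r d k : ℝ} (hn : 0 < n) (hm : 0 < n + k) :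
    (r + d) / (n + k) - r / n - 1 / 3 =
      (3 * n * d - 3 * r * k - n * (n + k)) / (3 * n * (n + k)) := by
  field_simp
  ring

/-! ### Connectedness and splitting along an edge -/

/-- Edges may collapse to points, so this covers both contraction and the retraction of a set onto
one side of an edge. -/
theorem Connected.of_surjective {V V' : Type*} {G : SimpleGraph V} {G' : SimpleGraph V'}
    (hG : G.Connected) (f : V → V') (hf : Function.Surjective f)
    (h : ∀ x y, G.Adj x y → f x = f y ∨ G'.Adj (f x) (f y)) : G'.Connected := by
  have hr : ∀ x y, G.Reachable x y → G'.Reachable (f x) (f y) := by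
    intro x y hxy
    rw [reachable_iff_reflTransGen] at hxy
    induction hxy with
    | refl => rfl
    | tail _ ha ih =>
      rcases h _ _ ha with h' | h'
      · rwa [← h']
      · exact ih.trans h'.reachable
  have := hG.nonempty.map f
  refine ⟨fun x y => ?_⟩
  obtain ⟨x, rfl⟩ := hf x
  obtain ⟨y, rfl⟩ := hf y
  exact hr _ _ (hG.preconnected x y)

variable {V : Type*} {G : SimpleGraph V}

/-- The vertex sets `A` and `B` are disjoint and `uw` is the only edge between them. -/
structure IsJoin (G : SimpleGraph V) (u w : V) (A B : Finset V) : Prop where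
  left_mem : u ∈ A
  right_mem : w ∈ B
  disjoint : Disjoint A B
  adj : G.Adj u w
  adj_imp : ∀ x ∈ A, ∀ y ∈ B, G.Adj x y → x = u ∧ y = w

theorem IsJoin.symm {u w : V} {A B : Finset V} (h : G.IsJoin u w A B) : G.IsJoin w u B A :=
  ⟨h.right_mem, h.left_mem, h.disjoint.symm, h.adj.symm,
    fun x hx y hy hxy => (h.adj_imp y hy x hx hxy.symm).symm⟩

/-- A walk inside `S` starting in `A` can leave `A` only across `uw`. -/
theorem IsJoin.mem_and_mem [DecidableEq V] {u w : V} {A B S : Finset V} (h : G.IsJoin u w A B)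
    (hS : (G.induce (S : Set V)).Connected) (hSAB : S ⊆ A ∪ B) {x y : V} (hxS : x ∈ S)
    (hyS : y ∈ S) (hx : x ∈ A) (hy : y ∈ B) : u ∈ S ∧ w ∈ S := by
  have key : ∀ z : (S : Set V), (G.induce (S : Set V)).Reachable ⟨x, hxS⟩ z →
      (z : V) ∈ A ∨ u ∈ S ∧ w ∈ S := by
    intro z hz
    rw [reachable_iff_reflTransGen] at hz
    induction hz with
    | refl => exact Or.inl hx
    | @tail b c _ ha ih =>
      rcases ih with ih | ih
      · rcases Finset.mem_union.1 (hSAB c.2) with hc | hc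
        · exact Or.inl hc
        · obtain ⟨h1, h2⟩ := h.adj_imp _ ih _ hc ha
          exact Or.inr ⟨h1 ▸ b.2, h2 ▸ c.2⟩
      · exact Or.inr ih
  rcases key ⟨y, hyS⟩ (hS.preconnected _ _) with h' | h'
  · exact absurd hy (Finset.disjoint_left.1 h.disjoint h')
  · exact h'

/-- Sending all of `S` outside `A` to `u` retracts `S` onto `S ∩ A`; the only crossing edge `uw`
collapses. -/
theorem IsJoin.connected_inter [DecidableEq V] {u w : V} {A B S : Finset V} (h : G.IsJoin u w A B)
    (hS : (G.induce (S : Set V)).Connected) (hSAB : S ⊆ A ∪ B) (hu : u ∈ S) :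
    (G.induce ((S ∩ A : Finset V) : Set V)).Connected := by
  have hf : ∀ z : (S : Set V), (if (z : V) ∈ A then (z : V) else u) ∈
      ((S ∩ A : Finset V) : Set V) := by
    intro z
    have := h.left_mem
    have := z.2
    split_ifs <;> simp_all
  refine hS.of_surjective (fun z => ⟨_, hf z⟩) ?_ ?_
  · rintro ⟨z, hz⟩
    have hz' := Finset.mem_inter.1 (Finset.mem_coe.1 hz)
    exact ⟨⟨z, hz'.1⟩, Subtype.ext (if_pos hz'.2)⟩
  · rintro ⟨x, hx⟩ ⟨y, hy⟩ hxy
    have hxy' : G.Adj x y := hxy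
    have hB : ∀ z ∈ S, z ∉ A → z ∈ B := fun z hz hzA =>
      (Finset.mem_union.1 (hSAB hz)).resolve_left hzA
    simp only [Subtype.mk.injEq, induce_adj]
    by_cases hxA : x ∈ A <;> by_cases hyA : y ∈ A
    · simp [hxA, hyA, hxy']
    · simp [hyA, (h.adj_imp x hxA y (hB y hy hyA) hxy').1]
    · simp [hxA, (h.adj_imp y hyA x (hB x hx hxA) hxy'.symm).1]
    · simp [hxA, hyA]

theorem connected_induce_setOf_reachable (G : SimpleGraph V) (v : V) :
    (G.induce {x | G.Reachable v x}).Connected := by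
  have h : (G.connectedComponentMk v).supp = {x | G.Reachable v x} := by
    ext x
    rw [ConnectedComponent.mem_supp_iff, ConnectedComponent.eq, reachable_comm]
    rfl
  rw [← h]
  exact (G.connectedComponentMk v).connected_toSimpleGraph

/-- A connected vertex set of an acyclic graph splits along each edge it spans. -/
theorem IsAcyclic.exists_isJoin [Finite V] [DecidableEq V] (hG : G.IsAcyclic) {W : Finset V}
    (hW : (G.induce (W : Set V)).Connected) {u w : V} (hu : u ∈ W) (hw : w ∈ W)
    (huw : G.Adj u w) :
    ∃ A B : Finset V, W = A ∪ B ∧ G.IsJoin u w A B ∧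
      (G.induce (A : Set V)).Connected ∧ (G.induce (B : Set V)).Connected := by
  classical
  have := Fintype.ofFinite V
  -- `H` keeps the edges within `W` other than `uw`. Since `uw` is a bridge of `G`, its ends lie in
  -- different components of `H`, which are the two parts sought.
  let H : SimpleGraph V :=
    { Adj := fun x y => x ∈ W ∧ y ∈ W ∧ G.Adj x y ∧ s(x, y) ≠ s(u, w)
      symm := ⟨fun x y h => ⟨h.2.1, h.1, h.2.2.1.symm, by rw [Sym2.eq_swap]; exact h.2.2.2⟩⟩
      loopless := ⟨fun x h => G.loopless.irrefl x h.2.2.1⟩ }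
  have hHG : H ≤ G := fun x y h => h.2.2.1
  have hnr : ¬ H.Reachable u w := by
    intro h
    have h1 := isAcyclic_iff_forall_adj_isBridge.1 hG huw
    refine isBridge_iff.1 h1 (h.mono ?_)
    intro x y hxy
    rw [deleteEdges_adj]
    exact ⟨hxy.2.2.1, hxy.2.2.2⟩
  have hmem : ∀ v ∈ W, ∀ x, H.Reachable v x → x ∈ W := by
    intro v hv x hx
    rw [reachable_iff_reflTransGen] at hx
    induction hx with
    | refl => exact hv
    | tail _ h _ => exact h.2.1
  have hconn : ∀ v, (G.induce ((Finset.univ.filter fun x => H.Reachable v x : Finset V) :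
      Set V)).Connected := by
    intro v
    have h := H.connected_induce_setOf_reachable v
    rw [Finset.coe_filter_univ]
    exact h.mono fun x y hxy => hHG hxy
  refine ⟨Finset.univ.filter fun x => H.Reachable u x, Finset.univ.filter fun x => H.Reachable w x,
    ?_, ⟨by simp, by simp, ?_, huw, ?_⟩, hconn u, hconn w⟩
  · ext x
    simp only [Finset.mem_union, Finset.mem_filter, Finset.mem_univ, true_and]
    constructor
    · intro hx
      have hr := hW.preconnected ⟨u, hu⟩ ⟨x, hx⟩
      rw [reachable_iff_reflTransGen] at hr
      have : ∀ z : (W : Set V), Relation.ReflTransGen (G.induce (W : Set V)).Adj ⟨u, hu⟩ z →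
          H.Reachable u z ∨ H.Reachable w z := by
        intro z hz
        induction hz with
        | refl => exact Or.inl (Reachable.refl _)
        | @tail b c _ ha ih =>
          by_cases he : s((b : V), (c : V)) = s(u, w)
          · rcases Sym2.eq_iff.1 he with ⟨_, h2⟩ | ⟨_, h2⟩
            · exact Or.inr (h2 ▸ Reachable.refl _)
            · exact Or.inl (h2 ▸ Reachable.refl _)
          · have hadj : H.Adj b c := ⟨b.2, c.2, ha, he⟩
            exact ih.imp (·.trans hadj.reachable) (·.trans hadj.reachable)
      exact this _ hr
    · rintro (h | h)
      exacts [hmem u hu x h, hmem w hw x h]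
  · rw [Finset.disjoint_left]
    intro x h1 h2
    simp only [Finset.mem_filter, Finset.mem_univ, true_and] at h1 h2
    exact hnr (h1.trans h2.symm)
  · intro x hx y hy hxy
    simp only [Finset.mem_filter, Finset.mem_univ, true_and] at hx hy
    by_cases he : s(x, y) = s(u, w)
    · rcases Sym2.eq_iff.1 he with h | h
      · exact h
      · exact absurd (h.1 ▸ hx) hnr
    · have hadj : H.Adj x y := ⟨hmem u hu x hx, hmem w hw y hy, hxy, he⟩
      exact absurd (hx.trans (hadj.reachable.trans hy.symm)) hnr

/-- `W` is built from `u` by repeatedly joining rooted pieces along single edges. -/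
inductive IsRootedPiece [DecidableEq V] (G : SimpleGraph V) : V → Finset V → Prop
  | single (u : V) : IsRootedPiece G u {u}
  | join {u w : V} {A B : Finset V} (hA : IsRootedPiece G u A) (hB : IsRootedPiece G w B)
      (h : G.IsJoin u w A B) : IsRootedPiece G u (A ∪ B)

theorem IsAcyclic.isRootedPiece [Finite V] [DecidableEq V] (hG : G.IsAcyclic) (W : Finset V) :
    ∀ u ∈ W, (G.induce (W : Set V)).Connected → G.IsRootedPiece u W := by
  induction W using Finset.strongInduction with
  | H W ih =>
    intro u hu hW
    by_cases hWu : W = {u}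
    · rw [hWu]; exact .single u
    · have : Nontrivial (W : Set V) := by
        rw [Set.nontrivial_coe_sort]
        refine (Set.nontrivial_iff_ne_singleton (a := u) hu).2 fun h => hWu ?_
        exact_mod_cast h
      obtain ⟨⟨w, hw⟩, hadj⟩ := hW.preconnected.exists_adj_of_nontrivial ⟨u, hu⟩
      obtain ⟨A, B, rfl, hj, hA, hB⟩ := hG.exists_isJoin hW hu hw hadj
      refine .join (ih A ?_ u hj.left_mem hA) (ih B ?_ w hj.right_mem hB) hj
      · refine Finset.ssubset_iff_subset_ne.2 ⟨Finset.subset_union_left, fun h => ?_⟩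
        exact Finset.disjoint_left.1 hj.disjoint (h ▸ hw) hj.right_mem
      · refine Finset.ssubset_iff_subset_ne.2 ⟨Finset.subset_union_right, fun h => ?_⟩
        exact Finset.disjoint_left.1 hj.disjoint hj.left_mem (h ▸ hu)

/-! ### Counting connected sets across a join -/

open Classical in
/-- The connected subsets of `W` that contain `u`. -/
noncomputable def rootedSets (G : SimpleGraph V) (u : V) (W : Finset V) : Finset (Finset V) :=
  W.powerset.filter fun S => u ∈ S ∧ (G.induce (S : Set V)).Connected

open Classical in
/-- The connected subsets of `W` that avoid `u`. -/
noncomputable def avoidingSets (G : SimpleGraph V) (u : V) (W : Finset V) : Finset (Finset V) :=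
  W.powerset.filter fun S => u ∉ S ∧ (G.induce (S : Set V)).Connected

open Classical in
/-- The connected subsets of `W` that contain both `u` and `w`. -/
noncomputable def spanningSets (G : SimpleGraph V) (u w : V) (W : Finset V) :
    Finset (Finset V) :=
  W.powerset.filter fun S => (u ∈ S ∧ w ∈ S) ∧ (G.induce (S : Set V)).Connected

theorem mem_rootedSets {u : V} {W S : Finset V} :
    S ∈ G.rootedSets u W ↔ S ⊆ W ∧ u ∈ S ∧ (G.induce (S : Set V)).Connected := by
  simp [rootedSets]

theorem mem_avoidingSets {u : V} {W S : Finset V} :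
    S ∈ G.avoidingSets u W ↔ S ⊆ W ∧ u ∉ S ∧ (G.induce (S : Set V)).Connected := by
  simp [avoidingSets]

theorem mem_spanningSets {u w : V} {W S : Finset V} :
    S ∈ G.spanningSets u w W ↔
      S ⊆ W ∧ (u ∈ S ∧ w ∈ S) ∧ (G.induce (S : Set V)).Connected := by
  simp [spanningSets]

theorem Connected.finset_nonempty {S : Finset V} (h : (G.induce (S : Set V)).Connected) :
    S.Nonempty := by
  obtain ⟨x⟩ := h.nonempty
  exact ⟨x.1, x.2⟩

theorem disjoint_rootedSets_avoidingSets (G : SimpleGraph V) (u : V) (W W' : Finset V) :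
    Disjoint (G.rootedSets u W) (G.avoidingSets u W') := by
  rw [Finset.disjoint_left]
  intro S h1 h2
  exact (mem_avoidingSets.1 h2).2.1 (mem_rootedSets.1 h1).2.1

theorem disjoint_of_subset_parts {𝒮 𝒯 : Finset (Finset V)} {A B : Finset V}
    (hAB : Disjoint A B)
    (h1 : ∀ S ∈ 𝒮, S ⊆ A ∧ S.Nonempty) (h2 : ∀ S ∈ 𝒯, S ⊆ B) : Disjoint 𝒮 𝒯 := by
  rw [Finset.disjoint_left]
  intro S hS hT
  obtain ⟨x, hx⟩ := (h1 S hS).2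
  exact Finset.disjoint_left.1 hAB ((h1 S hS).1 hx) (h2 S hT hx)

section Join

variable [DecidableEq V] {u w : V} {A B : Finset V}

theorem IsJoin.union_inter_left (h : G.IsJoin u w A B) {S R : Finset V} (hS : S ⊆ A)
    (hR : R ⊆ B) : (S ∪ R) ∩ A = S := by
  rw [Finset.union_inter_distrib_right, Finset.inter_eq_left.2 hS,
    Finset.disjoint_iff_inter_eq_empty.1 (h.disjoint.symm.mono_left hR), Finset.union_empty]

/-- A connected set containing both ends of `uw` is freely assembled from its traces on `A` and `B`.
The weight `f` is arbitrary so that `1` gives counts and the cardinality gives total orders. -/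
theorem IsJoin.sum_spanningSets (h : G.IsJoin u w A B) (f : Finset V → ℝ) :
    ∑ S ∈ G.spanningSets u w (A ∪ B), f S =
      ∑ p ∈ G.rootedSets u A ×ˢ G.rootedSets w B, f (p.1 ∪ p.2) := by
  symm
  refine Finset.sum_bij' (fun p _ => p.1 ∪ p.2) (fun S _ => (S ∩ A, S ∩ B)) ?_ ?_ ?_ ?_ ?_
  · rintro ⟨S, R⟩ hp
    obtain ⟨h1, h2⟩ := Finset.mem_product.1 hp
    obtain ⟨h1a, h1b, h1c⟩ := mem_rootedSets.1 h1
    obtain ⟨h2a, h2b, h2c⟩ := mem_rootedSets.1 h2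
    refine mem_spanningSets.2 ⟨Finset.union_subset_union h1a h2a,
      ⟨Finset.mem_union_left _ h1b, Finset.mem_union_right _ h2b⟩, ?_⟩
    rw [Finset.coe_union]
    exact connected_induce_union h1c.preconnected h2c.preconnected h1b h2b h.adj
  · intro S hS
    obtain ⟨h1, ⟨h2, h3⟩, h4⟩ := mem_spanningSets.1 hS
    refine Finset.mem_product.2 ⟨mem_rootedSets.2 ⟨Finset.inter_subset_right,
      Finset.mem_inter.2 ⟨h2, h.left_mem⟩, h.connected_inter h4 h1 h2⟩,
      mem_rootedSets.2 ⟨Finset.inter_subset_right,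
      Finset.mem_inter.2 ⟨h3, h.right_mem⟩, h.symm.connected_inter h4 ?_ h3⟩⟩
    rwa [Finset.union_comm]
  · rintro ⟨S, R⟩ hp
    obtain ⟨h1, h2⟩ := Finset.mem_product.1 hp
    have h1 := (mem_rootedSets.1 h1).1
    have h2 := (mem_rootedSets.1 h2).1
    refine Prod.ext (h.union_inter_left h1 h2) ?_
    change (S ∪ R) ∩ B = R
    rw [Finset.union_comm]
    exact h.symm.union_inter_left h2 h1
  · intro S hS
    rw [← Finset.inter_union_distrib_left]
    exact Finset.inter_eq_left.2 (mem_spanningSets.1 hS).1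
  · simp

theorem IsJoin.rootedSets_union (h : G.IsJoin u w A B) :
    G.rootedSets u (A ∪ B) = G.rootedSets u A ∪ G.spanningSets u w (A ∪ B) := by
  ext S
  simp only [Finset.mem_union, mem_rootedSets, mem_spanningSets]
  constructor
  · rintro ⟨h1, h2, h3⟩
    by_cases hw : w ∈ S
    · exact Or.inr ⟨h1, ⟨h2, hw⟩, h3⟩
    · refine Or.inl ⟨fun x hx => ?_, h2, h3⟩
      by_contra hxA
      have hxB := (Finset.mem_union.1 (h1 hx)).resolve_left hxA
      exact hw (h.mem_and_mem h3 h1 h2 hx h.left_mem hxB).2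
  · rintro (⟨h1, h2, h3⟩ | ⟨h1, h2, h3⟩)
    · exact ⟨h1.trans Finset.subset_union_left, h2, h3⟩
    · exact ⟨h1, h2.1, h3⟩

theorem IsJoin.disjoint_rootedSets (h : G.IsJoin u w A B) :
    Disjoint (G.rootedSets u A) (G.spanningSets u w (A ∪ B)) := by
  rw [Finset.disjoint_left]
  intro S h1 h2
  exact Finset.disjoint_left.1 h.disjoint ((mem_rootedSets.1 h1).1 (mem_spanningSets.1 h2).2.1.2)
    h.right_mem

/-- A connected set without `u` cannot use the edge `uw`, hence lies in one part; within `B` it may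
or may not contain `w`. -/
theorem IsJoin.avoidingSets_union (h : G.IsJoin u w A B) :
    G.avoidingSets u (A ∪ B) =
      G.avoidingSets u A ∪ (G.rootedSets w B ∪ G.avoidingSets w B) := by
  ext S
  simp only [Finset.mem_union, mem_rootedSets, mem_avoidingSets]
  constructor
  · rintro ⟨h1, h2, h3⟩
    by_cases hB : S ⊆ B
    · by_cases hw : w ∈ S
      · exact Or.inr (Or.inl ⟨hB, hw, h3⟩)
      · exact Or.inr (Or.inr ⟨hB, hw, h3⟩)
    · obtain ⟨x, hx, hxB⟩ := Finset.not_subset.1 hB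
      have hxA := (Finset.mem_union.1 (h1 hx)).resolve_right hxB
      refine Or.inl ⟨fun y hy => ?_, h2, h3⟩
      by_contra hyA
      have hyB := (Finset.mem_union.1 (h1 hy)).resolve_left hyA
      exact h2 (h.mem_and_mem h3 h1 hx hy hxA hyB).1
  · have hu : u ∉ B := Finset.disjoint_left.1 h.disjoint h.left_mem
    rintro (⟨h1, h2, h3⟩ | ⟨h1, -, h3⟩ | ⟨h1, -, h3⟩)
    · exact ⟨h1.trans Finset.subset_union_left, h2, h3⟩
    · exact ⟨h1.trans Finset.subset_union_right, fun h' => hu (h1 h'), h3⟩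
    · exact ⟨h1.trans Finset.subset_union_right, fun h' => hu (h1 h'), h3⟩

theorem IsJoin.sum_rootedSets (h : G.IsJoin u w A B) (f : Finset V → ℝ) :
    ∑ S ∈ G.rootedSets u (A ∪ B), f S = ∑ S ∈ G.rootedSets u A, f S +
      ∑ p ∈ G.rootedSets u A ×ˢ G.rootedSets w B, f (p.1 ∪ p.2) := by
  rw [h.rootedSets_union, Finset.sum_union h.disjoint_rootedSets, h.sum_spanningSets]

theorem IsJoin.sum_avoidingSets (h : G.IsJoin u w A B) (f : Finset V → ℝ) :
    ∑ S ∈ G.avoidingSets u (A ∪ B), f S = ∑ S ∈ G.avoidingSets u A, f S +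
      (∑ S ∈ G.rootedSets w B, f S + ∑ S ∈ G.avoidingSets w B, f S) := by
  rw [h.avoidingSets_union, Finset.sum_union,
    Finset.sum_union (disjoint_rootedSets_avoidingSets _ _ _ _)]
  refine disjoint_of_subset_parts h.disjoint (fun S hS => ?_) (fun S hS => ?_)
  · obtain ⟨h1, -, h3⟩ := mem_avoidingSets.1 hS
    exact ⟨h1, h3.finset_nonempty⟩
  · rcases Finset.mem_union.1 hS with h' | h'
    exacts [(mem_rootedSets.1 h').1, (mem_avoidingSets.1 h').1]

theorem IsJoin.sum_card_union (h : G.IsJoin u w A B) :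
    ∑ p ∈ G.rootedSets u A ×ˢ G.rootedSets w B, ((p.1 ∪ p.2).card : ℝ) =
      (∑ S ∈ G.rootedSets u A, (S.card : ℝ)) * (G.rootedSets w B).card +
      (G.rootedSets u A).card * ∑ S ∈ G.rootedSets w B, (S.card : ℝ) := by
  have : ∀ p ∈ G.rootedSets u A ×ˢ G.rootedSets w B,
      ((p.1 ∪ p.2).card : ℝ) = p.1.card + p.2.card := by
    intro p hp
    obtain ⟨h1, h2⟩ := Finset.mem_product.1 hp
    rw [Finset.card_union_of_disjoint (h.disjoint.mono (mem_rootedSets.1 h1).1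
      (mem_rootedSets.1 h2).1), Nat.cast_add]
  rw [Finset.sum_congr rfl this, Finset.sum_product]
  simp only [Finset.sum_add_distrib, Finset.sum_const, nsmul_eq_mul, Finset.mul_sum,
    Finset.sum_mul]
  congr 1
  exact Finset.sum_congr rfl fun _ _ => mul_comm _ _

end Join

/-- The number of connected subsets of `W` containing `u`. -/
noncomputable def rootedCount (G : SimpleGraph V) (u : V) (W : Finset V) : ℝ :=
  (G.rootedSets u W).card

/-- The total size of the connected subsets of `W` containing `u`. -/
noncomputable def rootedTotal (G : SimpleGraph V) (u : V) (W : Finset V) : ℝ :=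
  ∑ S ∈ G.rootedSets u W, (S.card : ℝ)

/-- The number of connected subsets of `W` avoiding `u`. -/
noncomputable def avoidingCount (G : SimpleGraph V) (u : V) (W : Finset V) : ℝ :=
  (G.avoidingSets u W).card

/-- The total size of the connected subsets of `W` avoiding `u`. -/
noncomputable def avoidingTotal (G : SimpleGraph V) (u : V) (W : Finset V) : ℝ :=
  ∑ S ∈ G.avoidingSets u W, (S.card : ℝ)

theorem rootedSets_singleton (G : SimpleGraph V) (u : V) : G.rootedSets u {u} = {{u}} := by
  ext S
  rw [mem_rootedSets, Finset.mem_singleton, Finset.subset_singleton_iff]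
  constructor
  · rintro ⟨rfl | rfl, h, -⟩
    · simp at h
    · rfl
  · rintro rfl
    refine ⟨Or.inr rfl, by simp, ?_⟩
    rw [Finset.coe_singleton]
    exact IsTree.of_subsingleton.connected

theorem avoidingSets_singleton (G : SimpleGraph V) (u : V) : G.avoidingSets u {u} = ∅ := by
  ext S
  rw [mem_avoidingSets, Finset.subset_singleton_iff]
  constructor
  · rintro ⟨rfl | rfl, h, hc⟩
    · exact absurd hc.finset_nonempty (by simp)
    · simp at h
  · simp

section Counts

variable [DecidableEq V] {u w : V} {A B : Finset V}

theorem IsJoin.rootedCount_union (h : G.IsJoin u w A B) :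
    G.rootedCount u (A ∪ B) = G.rootedCount u A + G.rootedCount u A * G.rootedCount w B := by
  have := h.sum_rootedSets fun _ => 1
  simpa [rootedCount] using this

theorem IsJoin.rootedTotal_union (h : G.IsJoin u w A B) :
    G.rootedTotal u (A ∪ B) = G.rootedTotal u A +
      (G.rootedTotal u A * G.rootedCount w B + G.rootedCount u A * G.rootedTotal w B) := by
  rw [rootedTotal, h.sum_rootedSets, h.sum_card_union]
  rfl

theorem IsJoin.avoidingCount_union (h : G.IsJoin u w A B) :
    G.avoidingCount u (A ∪ B) =
      G.avoidingCount u A + (G.rootedCount w B + G.avoidingCount w B) := by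
  have := h.sum_avoidingSets fun _ => 1
  simpa [rootedCount, avoidingCount] using this

theorem IsJoin.avoidingTotal_union (h : G.IsJoin u w A B) :
    G.avoidingTotal u (A ∪ B) =
      G.avoidingTotal u A + (G.rootedTotal w B + G.avoidingTotal w B) :=
  h.sum_avoidingSets _

theorem IsRootedPiece.rootedBounds {W : Finset V} (h : G.IsRootedPiece u W) :
    RootedBounds (G.rootedCount u W) (G.rootedTotal u W) (G.avoidingCount u W)
      (G.avoidingTotal u W) := by
  induction h with
  | single u =>
    simpa [rootedCount, rootedTotal, avoidingCount, avoidingTotal, rootedSets_singleton,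
      avoidingSets_singleton] using RootedBounds.single
  | join hA hB h ihA ihB =>
    rw [h.rootedCount_union, h.rootedTotal_union, h.avoidingCount_union, h.avoidingTotal_union]
    exact ihA.join ihB

/-- A rooted piece whose root lies in only one connected subset is a single vertex. -/
theorem IsRootedPiece.eq_singleton {W : Finset V} (h : G.IsRootedPiece u W)
    (h1 : G.rootedCount u W = 1) : W = {u} := by
  cases h with
  | single => rfl
  | join hA hB h =>
    rw [h.rootedCount_union] at h1
    have := hA.rootedBounds.one_le
    have := hB.rootedBounds.one_le
    nlinarith

end Counts

/-! ### Path enumerations -/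

/-- `f 0, …, f (n - 1)` enumerates `W`, without repetition, as an induced path. -/
structure IsPathEnumeration (G : SimpleGraph V) (n : ℕ) (f : ℕ → V) (W : Finset V) : Prop where
  inj : ∀ i < n, ∀ j < n, f i = f j → i = j
  mem_iff : ∀ x, x ∈ W ↔ ∃ i < n, f i = x
  adj_iff : ∀ i < n, ∀ j < n, G.Adj (f i) (f j) ↔ i + 1 = j ∨ j + 1 = i

/-- `W` induces a path with end `u`. -/
def IsEndPath (G : SimpleGraph V) (u : V) (W : Finset V) : Prop :=
  ∃ n f, G.IsPathEnumeration (n + 1) f W ∧ f 0 = u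

theorem IsPathEnumeration.reverse {n : ℕ} {f : ℕ → V} {W : Finset V}
    (h : G.IsPathEnumeration (n + 1) f W) :
    G.IsPathEnumeration (n + 1) (fun i => f (n - i)) W := by
  refine ⟨fun i hi j hj hij => ?_, fun x => ?_, fun i hi j hj => ?_⟩
  · have := h.inj _ (by omega) _ (by omega) hij
    omega
  · rw [h.mem_iff]
    constructor
    · rintro ⟨i, hi, rfl⟩
      exact ⟨n - i, by omega, by congr 1; omega⟩
    · rintro ⟨i, hi, rfl⟩
      exact ⟨n - i, by omega, rfl⟩
  · rw [h.adj_iff _ (by omega) _ (by omega)]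
    omega

theorem IsPathEnumeration.append [DecidableEq V] {n m : ℕ} {f g : ℕ → V} {A B : Finset V}
    (hf : G.IsPathEnumeration (n + 1) f A) (hg : G.IsPathEnumeration m g B)
    (h : G.IsJoin (f n) (g 0) A B) :
    G.IsPathEnumeration (n + 1 + m) (fun i => if i < n + 1 then f i else g (i - (n + 1)))
      (A ∪ B) := by
  have hfA : ∀ i < n + 1, f i ∈ A := fun i hi => (hf.mem_iff _).2 ⟨i, hi, rfl⟩
  have hgB : ∀ i < m, g i ∈ B := fun i hi => (hg.mem_iff _).2 ⟨i, hi, rfl⟩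
  have hm : 0 < m := by
    obtain ⟨i, hi, -⟩ := (hg.mem_iff _).1 h.right_mem
    omega
  have hne : ∀ i < n + 1, ∀ j < m, f i ≠ g j := fun i hi j hj hij =>
    Finset.disjoint_left.1 h.disjoint (hfA i hi) (hij ▸ hgB j hj)
  have hcross : ∀ i < n + 1, ∀ j < m, G.Adj (f i) (g j) ↔ i = n ∧ j = 0 := by
    intro i hi j hj
    constructor
    · intro hadj
      obtain ⟨h1, h2⟩ := h.adj_imp _ (hfA i hi) _ (hgB j hj) hadj
      exact ⟨hf.inj _ hi _ (by omega) h1, hg.inj _ hj _ hm h2⟩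
    · rintro ⟨rfl, rfl⟩
      exact h.adj
  refine ⟨fun i hi j hj hij => ?_, fun x => ?_, fun i hi j hj => ?_⟩
  · by_cases h1 : i < n + 1 <;> by_cases h2 : j < n + 1 <;> simp only [h1, h2, if_true, if_false]
      at hij
    · exact hf.inj _ h1 _ h2 hij
    · exact absurd hij (hne _ h1 _ (by omega))
    · exact absurd hij.symm (hne _ h2 _ (by omega))
    · have := hg.inj _ (by omega) _ (by omega) hij
      omega
  · rw [Finset.mem_union, hf.mem_iff, hg.mem_iff]
    constructor
    · rintro (⟨i, hi, rfl⟩ | ⟨i, hi, rfl⟩)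
      · exact ⟨i, by omega, if_pos hi⟩
      · exact ⟨i + (n + 1), by omega, by rw [if_neg (by omega), Nat.add_sub_cancel]⟩
    · rintro ⟨i, hi, rfl⟩
      by_cases h1 : i < n + 1
      · exact Or.inl ⟨i, h1, by simp [h1]⟩
      · exact Or.inr ⟨i - (n + 1), by omega, by simp [h1]⟩
  · by_cases h1 : i < n + 1 <;> by_cases h2 : j < n + 1 <;> simp only [h1, h2, if_true, if_false]
    · exact hf.adj_iff _ h1 _ h2
    · rw [hcross _ h1 _ (by omega)]
      omega
    · rw [adj_comm, hcross _ h2 _ (by omega)]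
      omega
    · rw [hg.adj_iff _ (by omega) _ (by omega)]
      omega

theorem isEndPath_singleton (G : SimpleGraph V) (u : V) : G.IsEndPath u {u} := by
  refine ⟨0, fun _ => u, ⟨fun i hi j hj _ => by omega, fun x => ?_, fun i hi j hj => ?_⟩, rfl⟩
  · rw [Finset.mem_singleton]
    exact ⟨fun h => ⟨0, by omega, h.symm⟩, fun ⟨_, _, h⟩ => h.symm⟩
  · simp only [SimpleGraph.irrefl, false_iff]
    omega

/-- The first path is reversed so that it finishes at `u`, then the second continues from `w`. -/
theorem IsEndPath.exists_enumeration_union [DecidableEq V] {u w : V} {A B : Finset V}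
    (hA : G.IsEndPath u A) (hB : G.IsEndPath w B) (h : G.IsJoin u w A B) :
    ∃ n f, G.IsPathEnumeration n f (A ∪ B) := by
  obtain ⟨n, f, hf, rfl⟩ := hA
  obtain ⟨m, g, hg, rfl⟩ := hB
  exact ⟨_, _, hf.reverse.append hg (by simpa using h)⟩

theorem IsEndPath.insert_root [DecidableEq V] {u w : V} {B : Finset V}
    (hB : G.IsEndPath w B) (h : G.IsJoin u w {u} B) : G.IsEndPath u ({u} ∪ B) := by
  obtain ⟨m, g, hg, rfl⟩ := hB
  obtain ⟨n, f, hf, rfl⟩ := isEndPath_singleton G u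
  have hn : n = 0 := by
    have h1 : f n = f 0 := by simpa using (hf.mem_iff (f n)).2 ⟨n, by omega, rfl⟩
    exact hf.inj _ (by omega) _ (by omega) h1
  subst hn
  refine ⟨_, _, by simpa [add_assoc, add_comm, add_left_comm] using hf.append hg h, by simp⟩

theorem IsPathEnumeration.isPathGraph [Fintype V] {n : ℕ} {f : ℕ → V}
    (h : G.IsPathEnumeration n f Finset.univ) : G.IsPathGraph := by
  let e : Fin n ≃ V := Equiv.ofBijective (fun i => f i)
    ⟨fun i j hij => Fin.ext (h.inj _ i.2 _ j.2 hij), fun x => by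
      obtain ⟨i, hi, hx⟩ := (h.mem_iff x).1 (Finset.mem_univ x)
      exact ⟨⟨i, hi⟩, hx⟩⟩
  refine ⟨n, ⟨(RelIso.mk e ?_ : pathGraph n ≃g G).symm⟩⟩
  intro i j
  rw [pathGraph_adj]
  exact h.adj_iff _ i.2 _ j.2

/-! ### The equality case -/

section RootedPiece

variable [DecidableEq V] {u : V} {W : Finset V}

/-- Vanishing slack in a join forces `A = {u}`. Hanging `B` below a single new root leaves the slack
of `total_le` unchanged, so it vanishes for `B` too and induction applies. -/
theorem IsRootedPiece.isEndPath (h : G.IsRootedPiece u W)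
    (h0 : G.rootedCount u W ^ 2 + 2 * G.rootedCount u W - 3 * G.rootedTotal u W +
      G.avoidingCount u W = 0) : G.IsEndPath u W := by
  induction h with
  | single u => exact isEndPath_singleton G u
  | @join u w A B hA hB h ihA ihB =>
    rw [h.rootedCount_union, h.rootedTotal_union, h.avoidingCount_union] at h0
    have h1 := hA.rootedBounds.eq_zero_of_join hB.rootedBounds h0
    obtain rfl := hA.eq_singleton h1
    refine (ihB ?_).insert_root h
    have h2 : G.rootedTotal u {u} = 1 := by simp [rootedTotal, rootedSets_singleton]
    have h3 : G.avoidingCount u {u} = 0 := by simp [avoidingCount, avoidingSets_singleton]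
    rw [h1, h2, h3] at h0
    linarith

theorem IsRootedPiece.eq_singleton_or_adj (h : G.IsRootedPiece u W) :
    W = {u} ∨ ∃ x ∈ W, G.Adj u x := by
  cases h with
  | single => exact Or.inl rfl
  | join hA hB h => exact Or.inr ⟨_, Finset.mem_union_right _ h.right_mem, h.adj⟩

/-- The statistics of a path rooted at an end. -/
structure HasEndPathStatistics (a t α s : ℝ) : Prop where
  total : 2 * t = a * (a + 1)
  avoiding : 2 * α = a * (a - 1)
  avoiding_total : 6 * s = a * (a ^ 2 - 1)

theorem HasEndPathStatistics.joined_eq_zero {a t α s b r β q : ℝ}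
    (h₁ : HasEndPathStatistics a t α s) (h₂ : HasEndPathStatistics b r β q) :
    3 * (α + β + a * b) * (a * b + t + r)
      - 3 * (s + q + (t * b + a * r - a * b)) * (a + b)
      - (α + β + a * b) * (α + β + a * b + a + b) = 0 := by
  obtain rfl : t = a * (a + 1) / 2 := by linarith [h₁.total]
  obtain rfl : α = a * (a - 1) / 2 := by linarith [h₁.avoiding]
  obtain rfl : s = a * (a ^ 2 - 1) / 6 := by linarith [h₁.avoiding_total]
  obtain rfl : r = b * (b + 1) / 2 := by linarith [h₂.total]
  obtain rfl : β = b * (b - 1) / 2 := by linarith [h₂.avoiding]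
  obtain rfl : q = b * (b ^ 2 - 1) / 6 := by linarith [h₂.avoiding_total]
  ring

/-- The outside neighbour `v` uses up one of the at most two neighbours of the root, leaving room
for one child only. Hence every join has `A = {u}`, and `u` serves as the outside neighbour for `B`.
-/
theorem IsRootedPiece.hasEndPathStatistics (h : G.IsRootedPiece u W)
    (hdeg : ∀ x y₁ y₂ y₃, G.Adj x y₁ → G.Adj x y₂ → G.Adj x y₃ → y₁ = y₂ ∨ y₁ = y₃ ∨ y₂ = y₃)
    {v : V} (hv : v ∉ W) (huv : G.Adj u v) :
    HasEndPathStatistics (G.rootedCount u W) (G.rootedTotal u W) (G.avoidingCount u W)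
      (G.avoidingTotal u W) := by
  induction h generalizing v with
  | single u =>
    constructor <;> simp [rootedCount, rootedTotal, avoidingCount, avoidingTotal,
      rootedSets_singleton, avoidingSets_singleton]; norm_num
  | @join u w A B hA hB h ihA ihB =>
    rcases hA.eq_singleton_or_adj with rfl | ⟨x, hxA, hx⟩
    · obtain ⟨h1, h2, h3⟩ :=
        ihB (Finset.disjoint_left.1 h.disjoint h.left_mem) h.adj.symm
      rw [h.rootedCount_union, h.rootedTotal_union, h.avoidingCount_union,
        h.avoidingTotal_union]
      have e1 : G.rootedTotal u {u} = 1 := by simp [rootedTotal, rootedSets_singleton]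
      have e2 : G.avoidingCount u {u} = 0 := by simp [avoidingCount, avoidingSets_singleton]
      have e3 : G.rootedCount u {u} = 1 := by simp [rootedCount, rootedSets_singleton]
      have e4 : G.avoidingTotal u {u} = 0 := by simp [avoidingTotal, avoidingSets_singleton]
      rw [e1, e2, e3, e4]
      constructor <;> linarith
    · have hxB := Finset.disjoint_left.1 h.disjoint hxA
      rcases hdeg u x w v hx h.adj huv with h' | h' | h'
      · exact absurd (h' ▸ h.right_mem) hxB
      · exact absurd (Finset.mem_union_left _ (h' ▸ hxA)) hv
      · exact absurd (Finset.mem_union_right _ (h' ▸ h.right_mem)) hv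

end RootedPiece

theorem IsPathGraph.eq_of_adj_three (h : G.IsPathGraph) (x y₁ y₂ y₃ : V) (h₁ : G.Adj x y₁)
    (h₂ : G.Adj x y₂) (h₃ : G.Adj x y₃) : y₁ = y₂ ∨ y₁ = y₃ ∨ y₂ = y₃ := by
  obtain ⟨n, ⟨φ⟩⟩ := h
  rw [← φ.map_adj_iff, pathGraph_adj] at h₁ h₂ h₃
  have key : ∀ a b : V, (φ a).val = (φ b).val → a = b := fun a b hab =>
    φ.injective (Fin.ext hab)
  by_cases e1 : (φ y₁).val = (φ y₂).val
  · exact Or.inl (key _ _ e1)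
  by_cases e2 : (φ y₁).val = (φ y₃).val
  · exact Or.inr (Or.inl (key _ _ e2))
  · exact Or.inr (Or.inr (key _ _ (by omega)))

/-! ### Subtrees as connected vertex sets -/

section Subtrees

/-- If `H` missed an edge `xy` between its vertices, it would connect `x` to `y` without that edge,
yet every edge of an acyclic graph is a bridge. -/
theorem IsAcyclic.eq_induce_of_isTree (hG : G.IsAcyclic) {H : G.Subgraph} (hH : H.coe.IsTree) :
    H = (⊤ : G.Subgraph).induce H.verts := by
  refine Subgraph.ext rfl ?_
  ext x y
  simp only [Subgraph.induce_adj, Subgraph.top_adj]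
  refine ⟨fun h => ⟨H.edge_vert h, H.edge_vert h.symm, H.adj_sub h⟩, ?_⟩
  rintro ⟨hx, hy, hxy⟩
  by_contra hn
  refine isBridge_iff.1 (isAcyclic_iff_forall_adj_isBridge.1 hG hxy) ?_
  let φ : H.coe →g G.deleteEdges {s(x, y)} :=
    { toFun := fun z => z
      map_rel' := by
        rintro ⟨a, ha⟩ ⟨b, hb⟩ hab
        have hab' : H.Adj a b := hab
        rw [deleteEdges_adj]
        refine ⟨H.adj_sub hab', fun h => hn ?_⟩
        rcases Sym2.eq_iff.1 h with ⟨rfl, rfl⟩ | ⟨rfl, rfl⟩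
        exacts [hab', hab'.symm] }
  exact (hH.connected.preconnected ⟨x, hx⟩ ⟨y, hy⟩).map φ

open Classical in
/-- The vertex sets that induce a connected subgraph. -/
noncomputable def connectedSets [Fintype V] (G : SimpleGraph V) : Finset (Finset V) :=
  Finset.univ.filter fun S => (G.induce (S : Set V)).Connected

theorem mem_connectedSets [Fintype V] {S : Finset V} :
    S ∈ G.connectedSets ↔ (G.induce (S : Set V)).Connected := by
  simp [connectedSets]

theorem injective_induce_coe (G : SimpleGraph V) :
    Function.Injective fun S : Finset V => (⊤ : G.Subgraph).induce (S : Set V) :=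
  fun _ _ h => Finset.coe_injective (congrArg Subgraph.verts h)

theorem IsAcyclic.subtrees_eq [Fintype V] (hG : G.IsAcyclic) :
    G.subtrees = (fun S : Finset V => (⊤ : G.Subgraph).induce (S : Set V)) ''
      (G.connectedSets : Set (Finset V)) := by
  classical
  ext H
  simp only [Set.mem_image, Finset.mem_coe, mem_connectedSets]
  constructor
  · intro hH
    refine ⟨H.verts.toFinset, ?_, ?_⟩
    · rw [Set.coe_toFinset]
      exact Subgraph.Connected.induce_verts ⟨hH.connected⟩
    · rw [Set.coe_toFinset]
      exact (hG.eq_induce_of_isTree hH).symm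
  · rintro ⟨S, hS, rfl⟩
    refine ⟨?_, hG.subgraph _⟩
    rw [connected_induce_iff] at hS
    exact hS.coe

theorem IsAcyclic.meanSubtreeOrder_eq [Fintype V] (hG : G.IsAcyclic) :
    G.meanSubtreeOrder =
      (∑ S ∈ G.connectedSets, (S.card : ℝ)) / (∑ _S ∈ G.connectedSets, (1 : ℝ)) := by
  rw [meanSubtreeOrder, hG.subtrees_eq, finsum_mem_image (G.injective_induce_coe.injOn),
    Set.ncard_image_of_injective _ G.injective_induce_coe, Set.ncard_coe_finset,
    finsum_mem_coe_finset]
  simp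

end Subtrees

/-! ### Contracting an edge -/

section Contraction

variable {u w : V}

/-- The projection onto the vertices of the graph with `uw` contracted. -/
abbrev contractMk (u w : V) : V → Quotient (contractSetoid s(u, w)) :=
  Quotient.mk _

theorem contractMk_eq_iff {x y : V} :
    contractMk u w x = contractMk u w y ↔ x = y ∨ ((x = u ∨ x = w) ∧ (y = u ∨ y = w)) := by
  rw [contractMk, Quotient.eq]
  change x = y ∨ (x ∈ s(u, w) ∧ y ∈ s(u, w)) ↔ _
  simp

theorem contractMk_injOn (u w : V) : Set.InjOn (contractMk u w) {x | x ≠ u} := by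
  intro x hx y hy h
  simp only [Set.mem_ofPred_eq] at hx hy
  rw [contractMk_eq_iff] at h
  grind

theorem contractEdge_adj_or {x y : V} (h : G.Adj x y) :
    contractMk u w x = contractMk u w y ∨
      (G.contractEdge s(u, w)).Adj (contractMk u w x) (contractMk u w y) := by
  by_cases he : contractMk u w x = contractMk u w y
  · exact Or.inl he
  · exact Or.inr (map_adj_apply' h he)

theorem card_contract [Finite V] (huw : u ≠ w) :
    Nat.card (Quotient (contractSetoid s(u, w))) + 1 = Nat.card V := by
  classical
  have := Fintype.ofFinite V
  have h : (Finset.univ.erase u).image (contractMk u w) = Finset.univ := by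
    ext q
    simp only [Finset.mem_image, Finset.mem_erase, Finset.mem_univ, and_true, iff_true]
    obtain ⟨x, rfl⟩ := Quotient.exists_rep q
    by_cases hx : x = u
    · exact ⟨w, huw.symm, contractMk_eq_iff.2 (Or.inr ⟨Or.inr rfl, Or.inl hx⟩)⟩
    · exact ⟨x, hx, rfl⟩
  have h2 := Finset.card_image_of_injOn (s := Finset.univ.erase u)
    ((contractMk_injOn u w).mono (fun x hx => Finset.ne_of_mem_erase hx))
  rw [h, Finset.card_erase_of_mem (Finset.mem_univ u)] at h2
  rw [Nat.card_eq_fintype_card, Nat.card_eq_fintype_card, ← Finset.card_univ, ← Finset.card_univ,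
    h2]
  have : 0 < (Finset.univ : Finset V).card := Finset.card_pos.2 ⟨u, Finset.mem_univ u⟩
  omega

/-- The contraction is connected, has one vertex fewer, and its edges are images of edges other than
`uw`; so it has few enough edges to be a tree. -/
theorem IsTree.contractEdge [Finite V] (hG : G.IsTree) (huw : G.Adj u w) :
    (G.contractEdge s(u, w)).IsTree := by
  have hconn : (G.contractEdge s(u, w)).Connected :=
    hG.connected.of_surjective (contractMk u w) Quotient.mk_surjective
      fun x y h => contractEdge_adj_or h
  refine isTree_iff_connected_and_card.2 ⟨hconn, le_antisymm ?_
    hconn.card_vert_le_card_edgeSet_add_one⟩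
  have hsub : (G.contractEdge s(u, w)).edgeSet ⊆
      Sym2.map (contractMk u w) '' (G.edgeSet \ {s(u, w)}) := by
    intro e he
    induction e with
    | h p q =>
      obtain ⟨hne, x, y, hxy, rfl, rfl⟩ := (map_adj' _ _ _ _).1 he
      refine ⟨s(x, y), ⟨hxy, fun h => hne ?_⟩, rfl⟩
      refine contractMk_eq_iff.2 (Or.inr ?_)
      rcases Sym2.eq_iff.1 h with ⟨rfl, rfl⟩ | ⟨rfl, rfl⟩ <;> simp
  have h1 := (Set.ncard_le_ncard hsub).trans (Set.ncard_image_le (Set.toFinite _))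
  have h2 := Set.ncard_sdiff_singleton_add_one (G.mem_edgeSet.2 huw) (Set.toFinite _)
  have h3 := (isTree_iff_connected_and_card.1 hG).2
  have h4 := card_contract huw.ne
  change Set.ncard _ + 1 = _ at h3
  change Set.ncard _ + 1 ≤ _
  omega

/-- Walks lift edge by edge: two vertices in the same fibre are equal or are the ends of `uw`, hence
adjacent within the preimage. -/
theorem connected_preimage_contract (huw : G.Adj u w)
    {Q : Set (Quotient (contractSetoid s(u, w)))}
    (hQ : ((G.contractEdge s(u, w)).induce Q).Connected) :
    (G.induce (contractMk u w ⁻¹' Q)).Connected := by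
  have hfib : ∀ x y : (contractMk u w ⁻¹' Q), contractMk u w x = contractMk u w y →
      (G.induce (contractMk u w ⁻¹' Q)).Reachable x y := by
    rintro ⟨x, hx⟩ ⟨y, hy⟩ h
    by_cases hxy : x = y
    · subst hxy; rfl
    · have : G.Adj x y := by
        have h' : contractMk u w x = contractMk u w y := h
        rcases contractMk_eq_iff.1 h' with h | ⟨rfl | rfl, rfl | rfl⟩
        exacts [absurd h hxy, absurd rfl hxy, huw, huw.symm, absurd rfl hxy]
      exact Adj.reachable (G := G.induce _) this
  have key : ∀ p q : Q, ((G.contractEdge s(u, w)).induce Q).Reachable p q →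
      ∀ x y : (contractMk u w ⁻¹' Q), contractMk u w x = p → contractMk u w y = q →
      (G.induce (contractMk u w ⁻¹' Q)).Reachable x y := by
    intro p q hpq
    rw [reachable_iff_reflTransGen] at hpq
    induction hpq with
    | refl => exact fun x y hx hy => hfib x y (hx.trans hy.symm)
    | @tail b c _ hbc ih =>
      intro x y hx hy
      obtain ⟨hne, s, t, hst, hs, ht⟩ := (map_adj' _ _ _ _).1 hbc
      have hs' : s ∈ contractMk u w ⁻¹' Q :=
        (Set.mem_of_eq_of_mem hs b.2 : contractMk u w s ∈ Q)
      have ht' : t ∈ contractMk u w ⁻¹' Q :=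
        (Set.mem_of_eq_of_mem ht c.2 : contractMk u w t ∈ Q)
      have hadj : (G.induce (contractMk u w ⁻¹' Q)).Adj ⟨s, hs'⟩ ⟨t, ht'⟩ := hst
      exact (ih x ⟨s, hs'⟩ hx hs).trans (hadj.reachable.trans (hfib _ _ (ht.trans hy.symm)))
  obtain ⟨⟨q, hq⟩⟩ := hQ.nonempty
  obtain ⟨x, rfl⟩ := Quotient.exists_rep q
  have : Nonempty (contractMk u w ⁻¹' Q) := ⟨⟨x, hq⟩⟩
  exact ⟨fun x y => key ⟨_, x.2⟩ ⟨_, y.2⟩ (hQ.preconnected _ _) x y rfl rfl⟩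

open Classical in
/-- The connected vertex sets of the contraction correspond to the connected vertex sets that
contain both ends of the contracted edge or neither. -/
theorem sum_connectedSets_contractEdge [Fintype V] (huw : G.Adj u w)
    [Fintype (Quotient (contractSetoid s(u, w)))]
    (f : Finset (Quotient (contractSetoid s(u, w))) → ℝ) :
    ∑ Q ∈ (G.contractEdge s(u, w)).connectedSets, f Q =
      ∑ S ∈ G.connectedSets.filter (fun S => u ∈ S ↔ w ∈ S), f (S.image (contractMk u w)) := by
  have hcoe : ∀ Q : Finset (Quotient (contractSetoid s(u, w))),
      ((Finset.univ.filter fun x => contractMk u w x ∈ Q : Finset V) : Set V) =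
        contractMk u w ⁻¹' (Q : Set _) := by
    intro Q; ext x; simp
  have himage : ∀ Q : Finset (Quotient (contractSetoid s(u, w))),
      (Finset.univ.filter fun x => contractMk u w x ∈ Q : Finset V).image (contractMk u w) = Q := by
    intro Q
    ext q
    obtain ⟨x, rfl⟩ := Quotient.exists_rep q
    simp only [Finset.mem_image, Finset.mem_filter, Finset.mem_univ, true_and]
    exact ⟨fun ⟨y, hy, h⟩ => h ▸ hy, fun h => ⟨x, h, rfl⟩⟩
  refine Finset.sum_bij' (fun Q _ => Finset.univ.filter fun x => contractMk u w x ∈ Q)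
    (fun S _ => S.image (contractMk u w)) ?_ ?_ ?_ ?_ ?_
  · intro Q hQ
    rw [Finset.mem_filter, mem_connectedSets, hcoe]
    refine ⟨connected_preimage_contract huw (mem_connectedSets.1 hQ), ?_⟩
    have : contractMk u w u = contractMk u w w := contractMk_eq_iff.2 (by simp)
    simp [this]
  · intro S hS
    have hS := mem_connectedSets.1 (Finset.mem_filter.1 hS).1
    rw [mem_connectedSets]
    refine hS.of_surjective (fun x => ⟨contractMk u w x,
      Finset.mem_coe.2 (Finset.mem_image_of_mem _ x.2)⟩) ?_ ?_
    · rintro ⟨q, hq⟩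
      obtain ⟨x, hx, rfl⟩ := Finset.mem_image.1 (Finset.mem_coe.1 hq)
      exact ⟨⟨x, hx⟩, rfl⟩
    · intro x y hxy
      rw [Subtype.mk.injEq]
      exact contractEdge_adj_or hxy
  · exact fun Q _ => himage Q
  · intro S hS
    have hS := (Finset.mem_filter.1 hS).2
    ext x
    simp only [Finset.mem_image, Finset.mem_filter, Finset.mem_univ, true_and]
    constructor
    · rintro ⟨y, hy, h⟩
      rcases contractMk_eq_iff.1 h with rfl | ⟨rfl | rfl, rfl | rfl⟩ <;> simp_all
    · exact fun h => ⟨x, h, rfl⟩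
  · intro Q _
    rw [himage]

end Contraction

/-! ### The two means in terms of the rooted statistics -/

theorem connectedSets_eq [Fintype V] [DecidableEq V] (G : SimpleGraph V) (u : V) :
    G.connectedSets = G.rootedSets u Finset.univ ∪ G.avoidingSets u Finset.univ := by
  ext S
  simp only [Finset.mem_union, mem_connectedSets, mem_rootedSets, mem_avoidingSets,
    Finset.subset_univ, true_and, ← or_and_right]
  simp [em]

theorem IsJoin.sum_connectedSets [Fintype V] [DecidableEq V] {u w : V} {A B : Finset V}
    (h : G.IsJoin u w A B) (hAB : Finset.univ = A ∪ B) (f : Finset V → ℝ) :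
    ∑ S ∈ G.connectedSets, f S =
      (∑ S ∈ G.rootedSets u A, f S +
        ∑ p ∈ G.rootedSets u A ×ˢ G.rootedSets w B, f (p.1 ∪ p.2)) +
      (∑ S ∈ G.avoidingSets u A, f S +
        (∑ S ∈ G.rootedSets w B, f S + ∑ S ∈ G.avoidingSets w B, f S)) := by
  rw [G.connectedSets_eq u, Finset.sum_union (disjoint_rootedSets_avoidingSets _ _ _ _), hAB,
    h.sum_rootedSets, h.sum_avoidingSets]

open Classical in
theorem IsJoin.filter_connectedSets [Fintype V] {u w : V} {A B : Finset V}
    (h : G.IsJoin u w A B) (hAB : Finset.univ = A ∪ B) :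
    G.connectedSets.filter (fun S => u ∈ S ↔ w ∈ S) =
      G.spanningSets u w (A ∪ B) ∪ (G.avoidingSets u A ∪ G.avoidingSets w B) := by
  ext S
  have hS : S ⊆ A ∪ B := hAB ▸ Finset.subset_univ S
  simp only [Finset.mem_filter, Finset.mem_union, mem_connectedSets, mem_spanningSets,
    mem_avoidingSets]
  constructor
  · rintro ⟨hc, hiff⟩
    by_cases hu : u ∈ S
    · exact Or.inl ⟨hS, ⟨hu, hiff.1 hu⟩, hc⟩
    · have hw : w ∉ S := fun hw => hu (hiff.2 hw)
      obtain ⟨x, hx⟩ := hc.finset_nonempty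
      rcases Finset.mem_union.1 (hS hx) with hxA | hxB
      · refine Or.inr (Or.inl ⟨fun y hy => ?_, hu, hc⟩)
        by_contra hyA
        have hyB := (Finset.mem_union.1 (hS hy)).resolve_left hyA
        exact hu (h.mem_and_mem hc hS hx hy hxA hyB).1
      · refine Or.inr (Or.inr ⟨fun y hy => ?_, hw, hc⟩)
        by_contra hyB
        have hyA := (Finset.mem_union.1 (hS hy)).resolve_right hyB
        exact hu (h.mem_and_mem hc hS hy hx hyA hxB).1
  · rintro (⟨-, h2, hc⟩ | ⟨h1, hu, hc⟩ | ⟨h1, hw, hc⟩)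
    · exact ⟨hc, by simp [h2.1, h2.2]⟩
    · have : w ∉ S := fun hw => Finset.disjoint_left.1 h.disjoint (h1 hw) h.right_mem
      exact ⟨hc, by simp [hu, this]⟩
    · have : u ∉ S := fun hu => Finset.disjoint_left.1 h.disjoint h.left_mem (h1 hu)
      exact ⟨hc, by simp [hw, this]⟩

open Classical in
-- The projection is injective off `u`, so only sets containing both ends shrink, by one vertex. The
-- truncated subtraction is harmless, as `p.1 ∪ p.2` contains `u`.
theorem IsJoin.sum_connectedSets_contractEdge [Fintype V] {u w : V}
    [Fintype (Quotient (contractSetoid s(u, w)))] {A B : Finset V}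
    (h : G.IsJoin u w A B) (hAB : Finset.univ = A ∪ B) (g : ℕ → ℝ) :
    ∑ Q ∈ (G.contractEdge s(u, w)).connectedSets, g Q.card =
      ∑ p ∈ G.rootedSets u A ×ˢ G.rootedSets w B, g ((p.1 ∪ p.2).card - 1) +
      (∑ S ∈ G.avoidingSets u A, g S.card + ∑ S ∈ G.avoidingSets w B, g S.card) := by
  have hinj : ∀ S : Finset V, u ∉ S → (S.image (contractMk u w)).card = S.card := by
    intro S hu
    refine Finset.card_image_of_injOn ((contractMk_injOn u w).mono ?_)
    exact fun x hx hxu => hu (hxu ▸ hx)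
  have hspan : ∀ S ∈ G.spanningSets u w (A ∪ B),
      (S.image (contractMk u w)).card = S.card - 1 := by
    intro S hS
    obtain ⟨-, ⟨hu, hw⟩, -⟩ := mem_spanningSets.1 hS
    have himage : S.image (contractMk u w) = (S.erase u).image (contractMk u w) := by
      refine le_antisymm ?_ (Finset.image_subset_image (Finset.erase_subset _ _))
      refine Finset.image_subset_iff.2 fun x hx => ?_
      by_cases hxu : x = u
      · refine Finset.mem_image.2 ⟨w, Finset.mem_erase.2 ⟨h.adj.ne', hw⟩, ?_⟩
        exact contractMk_eq_iff.2 (Or.inr ⟨Or.inr rfl, Or.inl hxu⟩)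
      · exact Finset.mem_image_of_mem _ (Finset.mem_erase.2 ⟨hxu, hx⟩)
    rw [himage, hinj _ (Finset.notMem_erase u S), Finset.card_erase_of_mem hu]
  have hA : ∀ S ∈ G.avoidingSets u A, (S.image (contractMk u w)).card = S.card :=
    fun S hS => hinj S (mem_avoidingSets.1 hS).2.1
  have hB : ∀ S ∈ G.avoidingSets w B, (S.image (contractMk u w)).card = S.card :=
    fun S hS => hinj S fun hu =>
      Finset.disjoint_left.1 h.disjoint h.left_mem ((mem_avoidingSets.1 hS).1 hu)
  rw [SimpleGraph.sum_connectedSets_contractEdge h.adj, h.filter_connectedSets hAB,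
    Finset.sum_union, Finset.sum_union,
    ← h.sum_spanningSets (fun S => g (S.card - 1)),
    Finset.sum_congr rfl fun S hS => congrArg g (hspan S hS),
    Finset.sum_congr rfl fun S hS => congrArg g (hA S hS),
    Finset.sum_congr rfl fun S hS => congrArg g (hB S hS)]
  · refine disjoint_of_subset_parts h.disjoint (fun S hS => ?_)
      fun S hS => (mem_avoidingSets.1 hS).1
    obtain ⟨h1, -, h3⟩ := mem_avoidingSets.1 hS
    exact ⟨h1, h3.finset_nonempty⟩
  · rw [Finset.disjoint_left]
    intro S h1 h2
    obtain ⟨-, ⟨hu, hw⟩, -⟩ := mem_spanningSets.1 h1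
    rcases Finset.mem_union.1 h2 with h' | h'
    exacts [(mem_avoidingSets.1 h').2.1 hu, (mem_avoidingSets.1 h').2.1 hw]

open Classical in
theorem IsJoin.meanSubtreeOrder_eq [Fintype V] {u w : V} {A B : Finset V}
    (hG : G.IsAcyclic) (h : G.IsJoin u w A B) (hAB : Finset.univ = A ∪ B) :
    G.meanSubtreeOrder =
      ((G.avoidingTotal u A + G.avoidingTotal w B +
        (G.rootedTotal u A * G.rootedCount w B + G.rootedCount u A * G.rootedTotal w B -
          G.rootedCount u A * G.rootedCount w B)) +
        (G.rootedCount u A * G.rootedCount w B + G.rootedTotal u A + G.rootedTotal w B)) /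
      ((G.avoidingCount u A + G.avoidingCount w B + G.rootedCount u A * G.rootedCount w B) +
        (G.rootedCount u A + G.rootedCount w B)) := by
  rw [hG.meanSubtreeOrder_eq, h.sum_connectedSets hAB, h.sum_connectedSets hAB, h.sum_card_union]
  simp only [Finset.sum_const, Finset.card_product, nsmul_eq_mul, mul_one, Nat.cast_mul,
    rootedCount, rootedTotal, avoidingCount, avoidingTotal]
  congr 1 <;> ring

open Classical in
theorem IsJoin.meanSubtreeOrder_contractEdge_eq [Fintype V] {u w : V} {A B : Finset V}
    (hG : G.IsTree) (h : G.IsJoin u w A B) (hAB : Finset.univ = A ∪ B) :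
    (G.contractEdge s(u, w)).meanSubtreeOrder =
      (G.avoidingTotal u A + G.avoidingTotal w B +
        (G.rootedTotal u A * G.rootedCount w B + G.rootedCount u A * G.rootedTotal w B -
          G.rootedCount u A * G.rootedCount w B)) /
      (G.avoidingCount u A + G.avoidingCount w B + G.rootedCount u A * G.rootedCount w B) := by
  have := Fintype.ofFinite (Quotient (contractSetoid s(u, w)))
  have hsub : ∀ p ∈ G.rootedSets u A ×ˢ G.rootedSets w B,
      (((p.1 ∪ p.2).card - 1 : ℕ) : ℝ) = ((p.1 ∪ p.2).card : ℝ) - 1 := by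
    intro p hp
    have hu := (mem_rootedSets.1 (Finset.mem_product.1 hp).1).2.1
    rw [Nat.cast_pred (Finset.card_pos.2 ⟨u, Finset.mem_union_left _ hu⟩)]
  rw [(hG.contractEdge h.adj).isAcyclic.meanSubtreeOrder_eq,
    h.sum_connectedSets_contractEdge hAB fun _ => 1,
    h.sum_connectedSets_contractEdge hAB fun n => (n : ℝ), Finset.sum_congr rfl hsub,
    Finset.sum_sub_distrib, h.sum_card_union]
  simp only [Finset.sum_const, Finset.card_product, nsmul_eq_mul, mul_one, Nat.cast_mul,
    rootedCount, rootedTotal, avoidingCount, avoidingTotal]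
  congr 1 <;> ring

end SimpleGraph

theorem mainTheorem2 {V : Type*} [Finite V] (T : SimpleGraph V) (hT : T.IsTree)
    (e : Sym2 V) (he : e ∈ T.edgeSet) :
    T.meanSubtreeOrder - (T.contractEdge e).meanSubtreeOrder ≥ 1 / 3 ∧
      (T.meanSubtreeOrder - (T.contractEdge e).meanSubtreeOrder = 1 / 3 ↔ T.IsPathGraph) := by
  classical
  have := Fintype.ofFinite V
  induction e with
  | h u w =>
    have huw : T.Adj u w := he
    have hconn : (T.induce ((Finset.univ : Finset V) : Set V)).Connected := by
      rw [Finset.coe_univ]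
      exact (SimpleGraph.induceUnivIso T).connected_iff.2 hT.connected
    obtain ⟨A, B, hAB, hj, hA, hB⟩ := hT.isAcyclic.exists_isJoin hconn
      (Finset.mem_univ u) (Finset.mem_univ w) huw
    have pA := hT.isAcyclic.isRootedPiece A u hj.left_mem hA
    have pB := hT.isAcyclic.isRootedPiece B w hj.right_mem hB
    have bA := pA.rootedBounds
    have bB := pB.rootedBounds
    have ha : 0 < T.rootedCount u A := by linarith [bA.one_le]
    have hb : 0 < T.rootedCount w B := by linarith [bB.one_le]
    have hab := mul_pos ha hb
    have hN : 0 < T.avoidingCount u A + T.avoidingCount w B +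
        T.rootedCount u A * T.rootedCount w B := by
      linarith [bA.avoid_nonneg, bB.avoid_nonneg]
    have hdiff := SimpleGraph.mean_diff_eq
      (r := T.avoidingTotal u A + T.avoidingTotal w B +
        (T.rootedTotal u A * T.rootedCount w B + T.rootedCount u A * T.rootedTotal w B -
          T.rootedCount u A * T.rootedCount w B))
      (d := T.rootedCount u A * T.rootedCount w B + T.rootedTotal u A + T.rootedTotal w B)
      hN (by linarith : 0 < _ + (T.rootedCount u A + T.rootedCount w B))
    rw [← hj.meanSubtreeOrder_eq hT.isAcyclic hAB,
      ← hj.meanSubtreeOrder_contractEdge_eq hT hAB] at hdiff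
    have hlow := SimpleGraph.joined_lower_bound bA bB
    rw [← add_assoc] at hdiff
    have zA := div_nonneg bA.total_le ha.le
    have zB := div_nonneg bB.total_le hb.le
    have hden : 0 < 3 * (T.avoidingCount u A + T.avoidingCount w B +
        T.rootedCount u A * T.rootedCount w B) * (T.avoidingCount u A + T.avoidingCount w B +
        T.rootedCount u A * T.rootedCount w B + T.rootedCount u A + T.rootedCount w B) :=
      mul_pos (by linarith) (by linarith)
    have hlow0 := mul_nonneg hab.le (mul_nonneg (by norm_num : (0 : ℝ) ≤ 1 / 2) (add_nonneg zA zB))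
    refine ⟨?_, fun heq => ?_, fun hpath => ?_⟩
    · have := div_nonneg (hlow0.trans hlow) hden.le
      linarith
    · rw [heq, sub_self, eq_comm, div_eq_zero_iff, or_iff_left hden.ne'] at hdiff
      rw [hdiff] at hlow
      -- Equality of means kills the numerator, which dominates a positive multiple of the two
      -- normalised slacks of `total_le`; both therefore vanish.
      have hz := le_antisymm hlow hlow0
      rw [mul_eq_zero, or_iff_right hab.ne', mul_eq_zero, or_iff_right (by norm_num)] at hz
      have zA0 := (add_eq_zero_iff_of_nonneg zA zB).1 hz
      rw [div_eq_zero_iff, or_iff_left ha.ne', div_eq_zero_iff, or_iff_left hb.ne'] at zA0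
      obtain ⟨n, f, hf⟩ :=
        (pA.isEndPath zA0.1).exists_enumeration_union (pB.isEndPath zA0.2) hj
      rw [← hAB] at hf
      exact hf.isPathGraph
    · have hdeg := hpath.eq_of_adj_three
      -- Each end of `e` is the outside neighbour of the other side's root.
      have sA := pA.hasEndPathStatistics hdeg
        (Finset.disjoint_right.1 hj.disjoint hj.right_mem) huw
      have sB := pB.hasEndPathStatistics hdeg
        (Finset.disjoint_left.1 hj.disjoint hj.left_mem) huw.symm
      rw [sA.joined_eq_zero sB, zero_div] at hdiff
      linarith
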